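/- For graphs $F,G$ let $\mathrm{satex}(n,F:m,G)$ denote the minimum number of copies of $G$ in an $n$-vertex graph that contains at least $m$ copies of $F$, where a copy of a graph $H$ is a (not necessarily induced) subgraph isomorphic to $H$ (and the minimum is $\infty$ if there is no such $n$-vertex graph). Let $P_{k+1}$ be the path on $k+1$ vertices and $C_\ell$ the cycle on $\ell$ vertices. Let $k,q\ge 1$ be fixed integers with $qk\ge 2$, and let $m=m(n)$ be a sequence of non-negative integers with $m\gg n^{k+1-1/q}$, that is, $m(n)/n^{k+1-1/q}\to\infty$ as $n\to\infty$. Then $$\mathrm{satex}(n,P_{k+1}:m,C_{2qk})\ \ge\ \left(\frac{1}{4qk}+o(1)\right)\left(\frac{2m}{n}\right)^{2q}\qquad (n\to\infty).$$ That is, there is a sequence $\varepsilon_n\to 0$ such that for all sufficiently large $n$ every $n$-vertex graph with at least $m(n)$ copies of $P_{k+1}$ contains at least $\left(\frac{1}{4qk}+\varepsilon_n\right)\left(\frac{2m(n)}{n}\right)^{2q}$ copies of $C_{2qk}$. -/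

import Mathlib

open Filter Topology
open scoped ENNReal

/-- The supersaturation-extremal function `satex(n, F : m, G)`: the minimum number of copies of
`G` in a graph on `n` vertices that contains at least `m` copies of `F`, where a copy of `H` in a
graph is a (not necessarily induced) subgraph isomorphic to `H`. The value is `⊤` (the minimum over
the empty set) exactly when no `n`-vertex graph contains `m` copies of `F`. -/
noncomputable def satex {V W : Type*} (n : ℕ) (F : SimpleGraph V) (m : ℕ) (G : SimpleGraph W) :
    ℕ∞ :=
  ⨅ (Γ : SimpleGraph (Fin n)) (_ : m ≤ Γ.copyCount F), (Γ.copyCount G : ℕ∞)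

/-!
Let `A` be the adjacency matrix of a graph on `n` vertices with at least `m` copies of the path
with `k` edges, and put `l = q * k`. Every path gives two labelled paths, which are walks of
length `k`, so the entries of `A ^ k` sum to at least `2 * m`. The Rayleigh quotient at the
all-ones vector shows that some eigenvalue `λ` has `λ ^ k ≥ 2 * m / n`, and hence the number
`T = tr (A ^ (2 * l))` of closed walks of length `2 * l` is at least `(2 * m / n) ^ (2 * q)`
(`Matrix.IsHermitian.div_pow_le_sum_pow_diag`). A closed walk without repeated vertices is a
labelled cycle, and a cycle has at most `4 * l` labellings, so it remains to see that the closed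
walks with a repeated vertex are negligible compared to `T`.

A closed walk that is at `y` at two times differing by `d` consists of two closed walks at `y`, of
lengths `d` and `2 * l - d`. Spectrally, `(A ^ d) y y` is the `d`-th moment of a measure on the
eigenvalues, and the product of the two moments is largest for `d = 2`
(`Matrix.IsHermitian.pow_diag_mul_pow_diag_le`). This leaves
`D = ∑ y, (A ^ 2) y y * (A ^ (2 * l - 2)) y y`, which is at most
`T / K + K ^ (l - 1) * n ^ (2 * l - 2)` for every `K > 0`
(`SimpleGraph.sum_sq_diag_mul_pow_diag_le`). The growth condition on `m` says exactly that
`n ^ (2 * l - 2) = o ((2 * m / n) ^ (2 * q))`, so `K` can tend to infinity slowly enough for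
`D = o(T)`, with an error that depends on `m` and `n` only.
-/

/-! ### Powers of symmetric matrices through eigenvalues -/

namespace Matrix.IsHermitian
variable {V : Type*} [Fintype V] [DecidableEq V] {A : Matrix V V ℝ}

lemma pow_apply_eq_sum (hA : A.IsHermitian) (p : ℕ) (x y : V) :
    (A ^ p) x y = ∑ i, hA.eigenvalues i ^ p *
      (hA.eigenvectorBasis i x * hA.eigenvectorBasis i y) := by
  have h := congrArg (fun M => (M ^ p) x y) hA.spectral_theorem
  simp only [← map_pow] at h
  rw [h, Unitary.conjStarAlgAut_apply, Matrix.diagonal_pow, Matrix.mul_apply]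
  simp only [Matrix.mul_diagonal, Matrix.star_apply, eigenvectorUnitary_apply]
  refine Finset.sum_congr rfl fun i _ => ?_
  simp
  ring

lemma sum_eigenvectorBasis_sq (hA : A.IsHermitian) (i : V) :
    ∑ x, hA.eigenvectorBasis i x * hA.eigenvectorBasis i x = 1 := by
  have h := hA.eigenvectorBasis.orthonormal.1 i
  have h2 := EuclideanSpace.real_norm_sq_eq (hA.eigenvectorBasis i)
  rw [h] at h2
  simpa [sq] using h2.symm

lemma sum_pow_diag (hA : A.IsHermitian) (p : ℕ) :
    ∑ x, (A ^ p) x x = ∑ i, hA.eigenvalues i ^ p := by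
  simp_rw [hA.pow_apply_eq_sum]
  rw [Finset.sum_comm]
  simp_rw [← Finset.mul_sum, hA.sum_eigenvectorBasis_sq, mul_one]

/-- Parseval's identity for the all-ones vector. -/
lemma sum_sq_sum_eigenvectorBasis (hA : A.IsHermitian) :
    ∑ i, (∑ x, hA.eigenvectorBasis i x) ^ 2 = Fintype.card V := by
  have h : ∑ x, ∑ y, (A ^ 0) x y = Fintype.card V := by
    simp [Matrix.one_apply]
  rw [← h]
  simp_rw [hA.pow_apply_eq_sum, pow_zero, one_mul, sq, Finset.sum_mul_sum]
  rw [Finset.sum_comm]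
  refine Finset.sum_congr rfl fun x _ => ?_
  rw [Finset.sum_comm]

lemma sum_sum_pow_eq (hA : A.IsHermitian) (p : ℕ) :
    ∑ x, ∑ y, (A ^ p) x y =
      ∑ i, hA.eigenvalues i ^ p * (∑ x, hA.eigenvectorBasis i x) ^ 2 := by
  simp_rw [hA.pow_apply_eq_sum, sq, Finset.sum_mul_sum, Finset.mul_sum]
  rw [Finset.sum_comm]
  rw [Finset.sum_congr rfl fun y _ => Finset.sum_comm]
  rw [Finset.sum_comm]
  refine Finset.sum_congr rfl fun x _ => ?_
  rw [Finset.sum_comm]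

/-- If the entries of `A ^ k` sum to at least `s * |V|`, then `s` is at most the Rayleigh quotient
of `A ^ k` at the all-ones vector, hence at most some `λ ^ k` with `λ` an eigenvalue of `A`; that
single eigenvalue already contributes `s ^ (2 * q)` to the trace of `A ^ (2 * q * k)`. -/
lemma div_pow_le_sum_pow_diag (hA : A.IsHermitian) {k q : ℕ} {s : ℝ}
    (hs : 0 ≤ s) (h : s * Fintype.card V ≤ ∑ x, ∑ y, (A ^ k) x y) [Nonempty V] :
    s ^ (2 * q) ≤ ∑ x, (A ^ (2 * q * k)) x x := by
  obtain ⟨i, hi⟩ : ∃ i, s ≤ hA.eigenvalues i ^ k := by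
    by_contra! hcon
    -- A weighted average of the `λ ^ k`, with nonnegative weights of total `|V|`, cannot reach `s`.
    rw [hA.sum_sum_pow_eq, ← hA.sum_sq_sum_eigenvectorBasis, Finset.mul_sum] at h
    refine absurd h (not_le.2 (Finset.sum_lt_sum (fun i _ =>
      mul_le_mul_of_nonneg_right (hcon i).le (sq_nonneg _)) ?_))
    by_contra! h0
    have h1 : ∑ i, (∑ x, hA.eigenvectorBasis i x) ^ 2 = 0 := by
      refine Finset.sum_eq_zero fun i hi => ?_
      have h2 := h0 i hi
      have h3 := hcon i
      nlinarith [sq_nonneg (∑ x, hA.eigenvectorBasis i x)]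
    rw [hA.sum_sq_sum_eigenvectorBasis] at h1
    simp at h1
  rw [hA.sum_pow_diag]
  have hev : ∀ j, 0 ≤ hA.eigenvalues j ^ (2 * q * k) := fun j =>
    Even.pow_nonneg ⟨q * k, by ring⟩ _
  calc s ^ (2 * q) ≤ (hA.eigenvalues i ^ k) ^ (2 * q) := pow_le_pow_left₀ hs hi _
    _ = hA.eigenvalues i ^ (2 * q * k) := by rw [← pow_mul, mul_comm k]
    _ ≤ _ := Finset.single_le_sum (f := fun j => hA.eigenvalues j ^ (2 * q * k))
        (fun j _ => hev j) (Finset.mem_univ i)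

end Matrix.IsHermitian

/-- An instance of Muirhead's inequality: `(d, N - d)` is majorized by `(N - 2, 2)`. Since `N` is
even, the right-hand side depends only on `|a|` and `|b|`, so that arbitrary signs are allowed. -/
lemma pow_mul_pow_add_le {N d : ℕ} (hN : Even N) (h2 : 2 ≤ d) (hd : d + 2 ≤ N) (a b : ℝ) :
    a ^ d * b ^ (N - d) + b ^ d * a ^ (N - d) ≤ a ^ 2 * b ^ (N - 2) + b ^ 2 * a ^ (N - 2) := by
  obtain ⟨e, rfl⟩ := Nat.exists_eq_add_of_le h2
  obtain ⟨f, rfl⟩ := Nat.exists_eq_add_of_le hd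
  have e1 : 2 + e + 2 + f - (2 + e) = f + 2 := by omega
  have e2 : 2 + e + 2 + f - 2 = e + f + 2 := by omega
  have hef : Even (e + f + 2) := by
    rw [Nat.even_iff] at hN ⊢; omega
  rw [e1, e2]
  have key : ∀ x y : ℝ, 0 ≤ x → 0 ≤ y → x ^ e * y ^ f + y ^ e * x ^ f ≤
      x ^ (e + f) + y ^ (e + f) := by
    intro x y hx hy
    have : 0 ≤ (x ^ e - y ^ e) * (x ^ f - y ^ f) := by
      rcases le_total x y with h | h
      · exact mul_nonneg_of_nonpos_of_nonpos (sub_nonpos.2 (pow_le_pow_left₀ hx h _))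
          (sub_nonpos.2 (pow_le_pow_left₀ hx h _))
      · exact mul_nonneg (sub_nonneg.2 (pow_le_pow_left₀ hy h _))
          (sub_nonneg.2 (pow_le_pow_left₀ hy h _))
    rw [pow_add, pow_add]
    linarith
  calc a ^ (2 + e) * b ^ (f + 2) + b ^ (2 + e) * a ^ (f + 2)
      ≤ |a ^ (2 + e) * b ^ (f + 2)| + |b ^ (2 + e) * a ^ (f + 2)| :=
        add_le_add (le_abs_self _) (le_abs_self _)
    _ = |a| ^ 2 * |b| ^ 2 * (|a| ^ e * |b| ^ f + |b| ^ e * |a| ^ f) := by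
        simp only [abs_mul, abs_pow]; ring
    _ ≤ |a| ^ 2 * |b| ^ 2 * (|a| ^ (e + f) + |b| ^ (e + f)) :=
        mul_le_mul_of_nonneg_left (key _ _ (abs_nonneg _) (abs_nonneg _)) (by positivity)
    _ = |a| ^ 2 * |b| ^ (e + f + 2) + |b| ^ 2 * |a| ^ (e + f + 2) := by ring
    _ = _ := by rw [sq_abs, sq_abs, hef.pow_abs, hef.pow_abs]

namespace Matrix.IsHermitian
variable {V : Type*} [Fintype V] [DecidableEq V] {A : Matrix V V ℝ}

/-- `(A ^ d) y y` is the `d`-th moment of the spectral measure at `y`. A product of two moments with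
even total order `N` is largest at the split `2 + (N - 2)`. -/
lemma pow_diag_mul_pow_diag_le (hA : A.IsHermitian) {N d : ℕ} (hN : Even N) (h2 : 2 ≤ d)
    (hd : d + 2 ≤ N) (y : V) :
    (A ^ d) y y * (A ^ (N - d)) y y ≤ (A ^ 2) y y * (A ^ (N - 2)) y y := by
  -- Symmetrizing in the two eigenvalues makes the inequality hold term by term.
  have expand : ∀ a b : ℕ, 2 * ((A ^ a) y y * (A ^ b) y y) = ∑ i, ∑ j,
      (hA.eigenvectorBasis i y ^ 2 * hA.eigenvectorBasis j y ^ 2) *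
        (hA.eigenvalues i ^ a * hA.eigenvalues j ^ b
          + hA.eigenvalues j ^ a * hA.eigenvalues i ^ b) := by
    intro a b
    rw [show ∀ u v : ℝ, 2 * (u * v) = u * v + v * u from fun u v => by ring,
      hA.pow_apply_eq_sum a, hA.pow_apply_eq_sum b, Finset.sum_mul_sum, Finset.sum_mul_sum,
      ← Finset.sum_add_distrib]
    refine Finset.sum_congr rfl fun i _ => ?_
    rw [← Finset.sum_add_distrib]
    refine Finset.sum_congr rfl fun j _ => ?_
    ring
  have h : 2 * ((A ^ d) y y * (A ^ (N - d)) y y) ≤ 2 * ((A ^ 2) y y * (A ^ (N - 2)) y y) := by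
    rw [expand, expand]
    exact Finset.sum_le_sum fun i _ => Finset.sum_le_sum fun j _ =>
      mul_le_mul_of_nonneg_left (pow_mul_pow_add_le hN h2 hd _ _) (by positivity)
  linarith

/-- Compares the traces of two consecutive even powers. An eigenvalue `λ` with `λ ^ 2 ≥ K * |V|` is
charged to the first term on the right, any other to the second. -/
lemma mul_sum_pow_diag_le (hA : A.IsHermitian) {l : ℕ} {K : ℝ} (hK : 0 < K) :
    (Fintype.card V : ℝ) * ∑ x, (A ^ (2 * l)) x x ≤
      (∑ x, (A ^ (2 * (l + 1))) x x) / K + K ^ l * (Fintype.card V : ℝ) ^ (l + 2) := by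
  rw [hA.sum_pow_diag, hA.sum_pow_diag, Finset.mul_sum, Finset.sum_div]
  set n : ℝ := (Fintype.card V : ℝ)
  have hn : 0 ≤ n := Nat.cast_nonneg _
  have : K ^ l * n ^ (l + 2) = ∑ _i : V, K ^ l * n ^ (l + 1) := by
    rw [Finset.sum_const, nsmul_eq_mul, Finset.card_univ]; ring
  rw [this, ← Finset.sum_add_distrib]
  refine Finset.sum_le_sum fun i _ => ?_
  set t := hA.eigenvalues i ^ 2 with ht
  have t0 : 0 ≤ t := sq_nonneg _
  rw [pow_mul, pow_mul, ← ht]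
  rcases le_total t (K * n) with h | h
  · have h1 : t ^ l ≤ (K * n) ^ l := pow_le_pow_left₀ t0 h _
    have h2 : n * t ^ l ≤ n * (K * n) ^ l := mul_le_mul_of_nonneg_left h1 hn
    have h3 : 0 ≤ t ^ (l + 1) / K := by positivity
    calc n * t ^ l ≤ n * (K * n) ^ l := h2
      _ = K ^ l * n ^ (l + 1) := by rw [mul_pow]; ring
      _ ≤ _ := by linarith
  · have h1 : n ≤ t / K := by rwa [le_div_iff₀ hK, mul_comm]
    have h3 : 0 ≤ K ^ l * n ^ (l + 1) := by positivity
    calc n * t ^ l ≤ t / K * t ^ l := mul_le_mul_of_nonneg_right h1 (by positivity)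
      _ = t ^ (l + 1) / K := by ring
      _ ≤ _ := by linarith

end Matrix.IsHermitian

/-! ### Walks and powers of the adjacency matrix -/

namespace SimpleGraph

section Walks
variable {V : Type*} {G : SimpleGraph V}

/-- A walk splits at its `n`-th vertex. The cut vertex `w` is a variable with a proof of
`w = p.getVert n`, so that it can be substituted by another vertex. -/
lemma Walk.exists_eq_append {u v : V} (p : G.Walk u v) {n : ℕ} (hn : n ≤ p.length) :
    ∃ (w : V) (p₁ : G.Walk u w) (p₂ : G.Walk w v),
      p = p₁.append p₂ ∧ p₁.length = n ∧ w = p.getVert n := by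
  induction p generalizing n with
  | nil => exact ⟨_, .nil, .nil, by simp_all, by simp_all, by simp⟩
  | cons h p ih =>
    cases n with
    | zero => exact ⟨_, .nil, .cons h p, by simp, by simp, by simp⟩
    | succ n =>
      obtain ⟨w, p₁, p₂, h1, h2, h3⟩ := ih (n := n) (by simpa using hn)
      exact ⟨w, .cons h p₁, p₂, by simp [h1], by simp [h2], by simp [h3]⟩

lemma exists_walk_of_adj (f : ℕ → V) (k : ℕ) (hf : ∀ i < k, G.Adj (f i) (f (i + 1))) :
    ∃ p : G.Walk (f 0) (f k), p.length = k ∧ ∀ i ≤ k, p.getVert i = f i := by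
  induction k with
  | zero => exact ⟨.nil, by simp, by simp⟩
  | succ k ih =>
    obtain ⟨p, hp, hv⟩ := ih fun i hi => hf i (by omega)
    refine ⟨p.concat (hf k (by omega)), by simp [hp], fun i hi => ?_⟩
    rw [Walk.concat_eq_append, Walk.getVert_append, hp]
    rcases Nat.lt_succ_iff_lt_or_eq.1 (Nat.lt_succ_of_le hi) with h | h
    · rcases Nat.lt_succ_iff_lt_or_eq.1 h with h' | h'
      · rw [if_pos h', hv i h'.le]
      · subst h'; simp
    · subst h; simp

variable [Fintype V] [DecidableEq V] [DecidableRel G.Adj]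

lemma card_finsetWalkLength (n : ℕ) (u v : V) :
    ((G.finsetWalkLength n u v).card : ℝ) = (G.adjMatrix ℝ ^ n) u v := by
  rw [adjMatrix_pow_apply_eq_card_walk, card_set_walk_length_eq]

variable (G) in
/-- All closed walks of length `N`, together with their base points. -/
def closedWalks (N : ℕ) : Finset (Σ x, G.Walk x x) :=
  Finset.univ.sigma fun x => G.finsetWalkLength N x x

lemma mem_closedWalks {N : ℕ} {p : Σ x, G.Walk x x} : p ∈ G.closedWalks N ↔ p.2.length = N := by
  simp [closedWalks, mem_finsetWalkLength_iff]

lemma card_closedWalks (N : ℕ) :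
    ((G.closedWalks N).card : ℝ) = ∑ x, (G.adjMatrix ℝ ^ N) x x := by
  simp [closedWalks, Finset.card_sigma, card_finsetWalkLength]

/-- A closed walk `x → x` whose vertices number `i` and `i + d` are the same vertex `y` is cut
there into walks `x → y`, `y → y` and `y → x`; the outer two combine to a closed walk at `y` of
length `N - d`. -/
lemma card_closedWalks_getVert_eq_le {N i d : ℕ} (hN : i + d ≤ N) :
    (((G.closedWalks N).filter fun p => p.2.getVert i = p.2.getVert (i + d)).card : ℝ) ≤
      ∑ y, (G.adjMatrix ℝ ^ d) y y * (G.adjMatrix ℝ ^ (N - d)) y y := by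
  let D : Finset (Σ a : V × V, G.Walk a.1 a.2 × G.Walk a.2 a.2 × G.Walk a.2 a.1) :=
    Finset.univ.sigma fun a => G.finsetWalkLength i a.1 a.2 ×ˢ
      G.finsetWalkLength d a.2 a.2 ×ˢ G.finsetWalkLength (N - (i + d)) a.2 a.1
  let φ : (Σ a : V × V, G.Walk a.1 a.2 × G.Walk a.2 a.2 × G.Walk a.2 a.1) → Σ x, G.Walk x x :=
    fun t => ⟨t.1.1, t.2.1.append (t.2.2.1.append t.2.2.2)⟩
  have hsub : ((G.closedWalks N).filter fun p => p.2.getVert i = p.2.getVert (i + d)) ⊆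
      D.image φ := by
    rintro ⟨x, p⟩ hp
    rw [Finset.mem_filter, mem_closedWalks] at hp
    obtain ⟨hl, hv⟩ := hp
    dsimp only at hl hv
    obtain ⟨y, p₁, r, rfl, h1, -⟩ := p.exists_eq_append (n := i) (by omega)
    rw [Walk.length_append] at hl
    obtain ⟨z, p₂, p₃, rfl, h2, hz⟩ := r.exists_eq_append (n := d) (by omega)
    rw [Walk.length_append] at hl
    have hzy : z = y := by
      rw [hz]
      have e1 : (p₁.append (p₂.append p₃)).getVert (i + d) = (p₂.append p₃).getVert d := by
        rw [Walk.getVert_append, if_neg (by omega), h1, Nat.add_sub_cancel_left]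
      have e2 : (p₁.append (p₂.append p₃)).getVert i = y := by
        rw [Walk.getVert_append, if_neg (by omega), h1, Nat.sub_self, Walk.getVert_zero]
      rw [← e1, ← hv, e2]
    subst hzy
    refine Finset.mem_image.2 ⟨⟨(x, z), p₁, p₂, p₃⟩, ?_, rfl⟩
    simp only [D, Finset.mem_sigma, Finset.mem_univ, Finset.mem_product,
      mem_finsetWalkLength_iff, true_and]
    omega
  have hcard := (Finset.card_le_card hsub).trans Finset.card_image_le
  have hD : (D.card : ℝ) = ∑ y, (G.adjMatrix ℝ ^ d) y y * (G.adjMatrix ℝ ^ (N - d)) y y := by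
    simp only [D, Finset.card_sigma, Finset.card_product, Nat.cast_sum, Nat.cast_mul,
      card_finsetWalkLength, Fintype.sum_prod_type]
    rw [Finset.sum_comm]
    refine Finset.sum_congr rfl fun y _ => ?_
    rw [show N - d = (N - (i + d)) + i by omega, pow_add _ (N - (i + d)) i, Matrix.mul_apply,
      Finset.mul_sum]
    exact Finset.sum_congr rfl fun x _ => by ring
  rw [← hD]
  exact_mod_cast hcard

end Walks

section Matrix
variable {V : Type*} [Fintype V] [DecidableEq V] {G : SimpleGraph V} [DecidableRel G.Adj]

/-- Both sides are the degree of `y`. -/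
lemma adjMatrix_sq_diag (y : V) :
    (G.adjMatrix ℝ ^ 2) y y = ∑ z, G.adjMatrix ℝ y z := by
  rw [sq, Matrix.mul_apply]
  refine Finset.sum_congr rfl fun z _ => ?_
  by_cases h : G.Adj y z <;> simp [h, G.adj_comm z y]

lemma adjMatrix_sq_diag_le (y : V) : (G.adjMatrix ℝ ^ 2) y y ≤ Fintype.card V := by
  rw [adjMatrix_sq_diag, ← Finset.card_univ, ← nsmul_one, ← Finset.sum_const]
  refine Finset.sum_le_sum fun z _ => ?_
  by_cases h : G.Adj y z <;> simp [h]

lemma adjMatrix_pow_nonneg (N : ℕ) (x y : V) : 0 ≤ (G.adjMatrix ℝ ^ N) x y := by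
  rw [adjMatrix_pow_apply_eq_card_walk]; positivity

/-- The sum of the squared degrees is the sum of all codegrees `t`, the closed walks of length four
number the sum of all `t ^ 2`, and `t ≤ t ^ 2 / K + K`. -/
lemma sum_adjMatrix_sq_diag_sq_le {K : ℝ} (hK : 0 < K) :
    ∑ y, (G.adjMatrix ℝ ^ 2) y y * (G.adjMatrix ℝ ^ 2) y y ≤
      (∑ x, (G.adjMatrix ℝ ^ 4) x x) / K + K * (Fintype.card V : ℝ) ^ 2 := by
  have hsymm : ∀ x y, G.adjMatrix ℝ x y = G.adjMatrix ℝ y x := fun x y => by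
    simp [adjMatrix_apply, G.adj_comm]
  have hA : ∀ x z, (G.adjMatrix ℝ ^ 2) x z = (G.adjMatrix ℝ ^ 2) z x := fun x z => by
    rw [sq, Matrix.mul_apply, Matrix.mul_apply]
    exact Finset.sum_congr rfl fun y _ => by rw [hsymm x y, hsymm y z, mul_comm]
  have h1 : ∑ y, (G.adjMatrix ℝ ^ 2) y y * (G.adjMatrix ℝ ^ 2) y y =
      ∑ x, ∑ z, (G.adjMatrix ℝ ^ 2) x z := by
    simp_rw [adjMatrix_sq_diag, Finset.sum_mul_sum]
    rw [Finset.sum_comm]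
    refine Finset.sum_congr rfl fun x _ => ?_
    rw [Finset.sum_comm]
    refine Finset.sum_congr rfl fun z _ => ?_
    rw [sq, Matrix.mul_apply]
    exact Finset.sum_congr rfl fun y _ => by rw [hsymm y x]
  have h2 : ∑ x, (G.adjMatrix ℝ ^ 4) x x = ∑ x, ∑ z, (G.adjMatrix ℝ ^ 2) x z ^ 2 := by
    refine Finset.sum_congr rfl fun x _ => ?_
    rw [show 4 = 2 + 2 from rfl, pow_add, Matrix.mul_apply]
    exact Finset.sum_congr rfl fun z _ => by rw [hA z x, ← sq]
  have h3 : K * (Fintype.card V : ℝ) ^ 2 = ∑ _x : V, ∑ _z : V, K := by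
    simp only [Finset.sum_const, nsmul_eq_mul, Finset.card_univ]; ring
  rw [h1, h2, h3, Finset.sum_div, ← Finset.sum_add_distrib]
  refine Finset.sum_le_sum fun x _ => ?_
  rw [Finset.sum_div, ← Finset.sum_add_distrib]
  refine Finset.sum_le_sum fun z _ => ?_
  set t := (G.adjMatrix ℝ ^ 2) x z
  rw [← sub_nonneg, show t ^ 2 / K + K - t = ((t - K / 2) ^ 2 + 3 / 4 * K ^ 2) / K by
    field_simp; ring]
  positivity

/-- For `l ≥ 3` it is enough to bound `(A ^ 2) y y` by `|V|`. For `l = 2` that loses too much, and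
the bound through codegrees is used. -/
lemma sum_sq_diag_mul_pow_diag_le {l : ℕ} (hl : 2 ≤ l) {K : ℝ} (hK : 0 < K)
    (hV : 1 ≤ Fintype.card V) :
    ∑ y, (G.adjMatrix ℝ ^ 2) y y * (G.adjMatrix ℝ ^ (2 * l - 2)) y y ≤
      (∑ x, (G.adjMatrix ℝ ^ (2 * l)) x x) / K +
        K ^ (l - 1) * (Fintype.card V : ℝ) ^ (2 * l - 2) := by
  obtain ⟨j, rfl⟩ := Nat.exists_eq_add_of_le' hl
  rcases Nat.eq_zero_or_pos j with rfl | hj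
  · simpa using sum_adjMatrix_sq_diag_sq_le (G := G) hK
  · have e : 2 * (j + 2) - 2 = 2 * (j + 1) := by omega
    rw [e, show j + 2 - 1 = j + 1 by omega]
    calc _ ≤ ∑ y, (Fintype.card V : ℝ) * (G.adjMatrix ℝ ^ (2 * (j + 1))) y y :=
          Finset.sum_le_sum fun y _ =>
            mul_le_mul_of_nonneg_right (adjMatrix_sq_diag_le y) (adjMatrix_pow_nonneg _ _ _)
      _ = (Fintype.card V : ℝ) * ∑ y, (G.adjMatrix ℝ ^ (2 * (j + 1))) y y := by
          rw [Finset.mul_sum]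
      _ ≤ _ := (G.isHermitian_adjMatrix ℝ).mul_sum_pow_diag_le hK
      _ ≤ _ := by
          gcongr
          · exact_mod_cast hV
          · omega

end Matrix
end SimpleGraph

/-! ### Labelled and unlabelled copies -/

namespace SimpleGraph

section Copies
variable {V W : Type*} {G : SimpleGraph V} {H : SimpleGraph W}

/-- Copies with the same image differ by a copy of `H` in itself. -/
lemma Copy.exists_comp_eq {f g : Copy H G} (h : g.toSubgraph = f.toSubgraph) :
    ∃ σ : Copy H H, f.comp σ = g := by
  have hv : ∀ a, ∃ b, f b = g a := fun a => by
    have : g a ∈ g.toSubgraph.verts := ⟨a, trivial, rfl⟩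
    rw [h] at this
    obtain ⟨b, -, hb⟩ := this
    exact ⟨b, hb⟩
  choose σ hσ using hv
  have hadj : ∀ {a b}, H.Adj a b → H.Adj (σ a) (σ b) := fun {a b} hab => by
    have : g.toSubgraph.Adj (g a) (g b) := ⟨a, b, hab, rfl, rfl⟩
    rw [h, ← hσ, ← hσ] at this
    obtain ⟨c, d, hcd, hc, hd⟩ := this
    rwa [f.injective hc, f.injective hd] at hcd
  refine ⟨⟨⟨σ, hadj⟩, fun a b hab => g.injective ?_⟩, Copy.ext hσ⟩
  change g a = g b
  rw [← hσ, ← hσ]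
  exact congrArg f hab

variable [Fintype V] [Fintype W]

lemma labelledCopyCount_eq_card (G : SimpleGraph V) (H : SimpleGraph W) [Fintype (H.Copy G)] :
    G.labelledCopyCount H = Fintype.card (H.Copy G) := by
  rw [labelledCopyCount]
  exact congrArg (@Fintype.card _) (Subsingleton.elim _ _)

lemma finite_copy (G : SimpleGraph V) (H : SimpleGraph W) : Finite (H.Copy G) := DFunLike.finite _

/-- Each subgraph is the image of at most as many copies of `H` as there are copies of `H` in
itself. -/
lemma labelledCopyCount_le_mul_copyCount (G : SimpleGraph V) (H : SimpleGraph W) :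
    G.labelledCopyCount H ≤ H.labelledCopyCount H * G.copyCount H := by
  classical
  rw [copyCount_eq_card_image_copyToSubgraph, labelledCopyCount, labelledCopyCount,
    ← Finset.card_univ]
  refine Finset.card_le_mul_card_image _ _ fun S hS => ?_
  obtain ⟨f, -, rfl⟩ := Finset.mem_image.1 hS
  refine (Finset.card_le_card (t := Finset.univ.image fun σ : Copy H H => f.comp σ) ?_).trans
    Finset.card_image_le
  intro g hg
  obtain ⟨σ, hσ⟩ := Copy.exists_comp_eq (Finset.mem_filter.1 hg).2
  exact Finset.mem_image.2 ⟨σ, Finset.mem_univ _, hσ⟩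

/-- A copy and its composition with a nontrivial automorphism have the same image. -/
lemma two_mul_copyCount_le_labelledCopyCount (G : SimpleGraph V) (σ : H ≃g H)
    (hσ : ∃ a, σ a ≠ a) : 2 * G.copyCount H ≤ G.labelledCopyCount H := by
  classical
  rw [copyCount_eq_card_image_copyToSubgraph, labelledCopyCount, ← Finset.card_univ]
  refine Finset.mul_card_image_le_card _ _ fun S hS => ?_
  obtain ⟨f, -, rfl⟩ := Finset.mem_image.1 hS
  have hne : f ≠ f.comp σ.toCopy := fun h => by
    obtain ⟨a, ha⟩ := hσ
    exact ha (f.injective (DFunLike.congr_fun h a)).symm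
  rw [← Finset.card_pair hne]
  refine Finset.card_le_card fun g hg => ?_
  rw [Finset.mem_insert, Finset.mem_singleton] at hg
  refine Finset.mem_filter.2 ⟨Finset.mem_univ _, ?_⟩
  rcases hg with rfl | rfl
  · rfl
  · ext x y
    · simp only [Copy.toSubgraph, Subgraph.map_verts, Subgraph.verts_top, Set.image_univ]
      exact ⟨fun ⟨a, ha⟩ => ⟨σ a, ha⟩, fun ⟨a, ha⟩ => ⟨σ.symm a, by
        rw [← ha]; exact congrArg f (σ.apply_symm_apply a)⟩⟩
    · constructor
      · rintro ⟨a, b, hab, rfl, rfl⟩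
        exact ⟨σ a, σ b, σ.map_adj_iff.2 hab, rfl, rfl⟩
      · rintro ⟨a, b, hab, rfl, rfl⟩
        exact ⟨σ.symm a, σ.symm b, σ.symm.map_adj_iff.2 hab,
          congrArg f (σ.apply_symm_apply a), congrArg f (σ.apply_symm_apply b)⟩

end Copies

/-- Reversal of the path, as an automorphism. -/
def pathGraphRev (n : ℕ) : pathGraph n ≃g pathGraph n where
  toEquiv := Fin.revPerm
  map_rel_iff' {a b} := by
    simp only [pathGraph_adj, Fin.revPerm_apply, Fin.val_rev]
    omega

/-- A cycle has at most two automorphisms for each image of a given vertex, as an automorphism is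
determined by its values at two adjacent vertices. -/
lemma labelledCopyCount_cycleGraph_le (n : ℕ) :
    (cycleGraph (n + 3)).labelledCopyCount (cycleGraph (n + 3)) ≤ 2 * (n + 3) := by
  classical
  have hstep : ∀ (σ : Copy (cycleGraph (n + 3)) (cycleGraph (n + 3))) (t : Fin (n + 3)),
      σ (t + 1) = σ t + 1 ∨ σ (t + 1) = σ t - 1 := fun σ t => by
    have h1 : (cycleGraph (n + 3)).Adj (t + 1) t := by
      rw [cycleGraph_adj]; left; abel
    have h2 : (cycleGraph (n + 3)).Adj (σ (t + 1)) (σ t) := σ.toHom.map_adj h1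
    rw [cycleGraph_adj] at h2
    rcases h2 with h | h
    · exact Or.inl (sub_eq_iff_eq_add'.1 h)
    · exact Or.inr (eq_sub_of_add_eq (sub_eq_iff_eq_add'.1 h).symm)
  have hne : ∀ (σ : Copy (cycleGraph (n + 3)) (cycleGraph (n + 3))) (t : Fin (n + 3)),
      σ (t + 1 + 1) ≠ σ t := fun σ t h => by
    have h1 : t + 1 + 1 = t := σ.injective h
    rw [add_assoc, add_eq_left] at h1
    have h2 := congrArg Fin.val h1
    rw [Fin.val_add, Fin.val_one, Fin.val_zero, Nat.mod_eq_of_lt (by omega)] at h2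
    omega
  -- Of the two neighbours of `σ (t + 1)`, the vertex `σ (t + 2)` is the one different from `σ t`.
  have hdet : ∀ σ τ : Copy (cycleGraph (n + 3)) (cycleGraph (n + 3)),
      σ 0 = τ 0 → σ 1 = τ 1 → σ = τ := fun σ τ h0 h1 => by
    have h : ∀ t : Fin (n + 3), σ t = τ t ∧ σ (t + 1) = τ (t + 1) := by
      intro t
      induction t using Fin.induction with
      | zero => simpa using ⟨h0, h1⟩
      | succ t ih =>
        rw [← Fin.coeSucc_eq_succ]
        generalize t.castSucc = t at ih
        obtain ⟨ih0, ih1⟩ := ih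
        refine ⟨ih1, ?_⟩
        have a1 := hstep σ t
        have a2 := hstep σ (t + 1)
        have a3 := hne σ t
        have b2 := hstep τ (t + 1)
        have b3 := hne τ t
        rw [← ih1] at b2
        rw [← ih0] at b3
        rcases a1 with a1 | a1 <;> rw [a1] at a2 b2
        · rw [add_sub_cancel_right] at a2 b2
          rw [a2.resolve_right a3, b2.resolve_right b3]
        · rw [sub_add_cancel] at a2 b2
          rw [a2.resolve_left a3, b2.resolve_left b3]
    exact Copy.ext fun a => (h a).1
  have := finite_copy (cycleGraph (n + 3)) (cycleGraph (n + 3))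
  obtain ⟨_⟩ := nonempty_fintype (Copy (cycleGraph (n + 3)) (cycleGraph (n + 3)))
  rw [labelledCopyCount_eq_card]
  have hinj : Function.Injective
      (fun σ : Copy (cycleGraph (n + 3)) (cycleGraph (n + 3)) =>
        ((decide (σ 1 = σ 0 + 1), σ 0) : Bool × Fin (n + 3))) := by
    intro σ τ h
    simp only [Prod.mk.injEq, decide_eq_decide] at h
    refine hdet σ τ h.2 ?_
    have a := hstep σ 0
    have b := hstep τ 0
    rw [zero_add] at a b
    by_cases hs : σ 1 = σ 0 + 1
    · rw [hs, h.1.1 hs, h.2]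
    · rw [a.resolve_left hs, b.resolve_left (fun hb => hs (h.1.2 hb)), h.2]
  have := Fintype.card_le_of_injective _ hinj
  simpa using this

/-! ### From walks to paths and cycles -/

section Count
variable {V : Type*} [Fintype V] [DecidableEq V] {G : SimpleGraph V} [DecidableRel G.Adj]

/-- A labelled path with `k` edges is a walk of length `k`. -/
lemma labelledCopyCount_pathGraph_le (k : ℕ) :
    (G.labelledCopyCount (pathGraph (k + 1)) : ℝ) ≤ ∑ x, ∑ y, (G.adjMatrix ℝ ^ k) x y := by
  classical
  let D : Finset (Σ a : V × V, G.Walk a.1 a.2) :=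
    Finset.univ.sigma fun a => G.finsetWalkLength k a.1 a.2
  have hD : (D.card : ℝ) = ∑ x, ∑ y, (G.adjMatrix ℝ ^ k) x y := by
    simp only [D, Finset.card_sigma, Nat.cast_sum, card_finsetWalkLength, Fintype.sum_prod_type]
  have := finite_copy G (pathGraph (k + 1))
  obtain ⟨_⟩ := nonempty_fintype (Copy (pathGraph (k + 1)) G)
  rw [← hD, labelledCopyCount_eq_card, ← Finset.card_univ,
    ← Finset.card_image_of_injective _
      (DFunLike.coe_injective (F := Copy (pathGraph (k + 1)) G))]
  refine Nat.cast_le.2 ((Finset.card_le_card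
    (t := D.image fun p => fun i : Fin (k + 1) => p.2.getVert i) ?_).trans Finset.card_image_le)
  intro g hg
  obtain ⟨f, -, rfl⟩ := Finset.mem_image.1 hg
  obtain ⟨p, hp, hv⟩ := exists_walk_of_adj (G := G) (fun i => f (Fin.ofNat (k + 1) i)) k
    fun i hi => f.toHom.map_adj (by
      rw [pathGraph_adj]; left
      simp only [Fin.val_ofNat]
      rw [Nat.mod_eq_of_lt (by omega), Nat.mod_eq_of_lt (by omega)])
  refine Finset.mem_image.2 ⟨⟨(_, _), p⟩, ?_, ?_⟩
  · simp [D, mem_finsetWalkLength_iff, hp]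
  · funext i
    simp only
    rw [hv i (by omega)]
    congr 1
    ext
    simp

variable (G) in
open Classical in
/-- The closed walks of length `N` that visit some vertex at two different times before time
`N`. -/
noncomputable def degenerateClosedWalks (N : ℕ) : Finset (Σ x, G.Walk x x) :=
  (G.closedWalks N).filter fun p =>
    ∃ i d, 1 ≤ d ∧ i + d < N ∧ p.2.getVert i = p.2.getVert (i + d)

variable (G) in
lemma degenerateClosedWalks_subset (N : ℕ) : G.degenerateClosedWalks N ⊆ G.closedWalks N := by
  classical
  intro p hp
  rw [degenerateClosedWalks, Finset.mem_filter] at hp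
  exact hp.1

/-- A closed walk without repeated vertices is a labelled cycle. -/
lemma card_injective_closedWalks_le (n : ℕ) :
    (G.closedWalks (n + 2) \ G.degenerateClosedWalks (n + 2)).card ≤
      G.labelledCopyCount (cycleGraph (n + 2)) := by
  classical
  let Φ : (Σ x, G.Walk x x) → Fin (n + 2) → V := fun p i => p.2.getVert i.val
  have hinj : Set.InjOn Φ (G.closedWalks (n + 2) : Set (Σ x, G.Walk x x)) := by
    rintro ⟨x, p⟩ hp ⟨y, r⟩ hr h
    rw [Finset.mem_coe, mem_closedWalks] at hp hr
    dsimp only at hp hr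
    have hi : ∀ i (_ : i < n + 2), p.getVert i = r.getVert i := fun i hi => congrFun h ⟨i, hi⟩
    have h0 : x = y := by simpa using hi 0 (by omega)
    subst h0
    congr 1
    refine Walk.ext_getVert fun i => ?_
    rcases lt_or_ge i (n + 2) with h | h
    · exact hi i h
    · rw [p.getVert_of_length_le (by omega), r.getVert_of_length_le (by omega)]
  have := finite_copy G (cycleGraph (n + 2))
  obtain ⟨_⟩ := nonempty_fintype (Copy (cycleGraph (n + 2)) G)
  rw [labelledCopyCount_eq_card, ← Finset.card_univ,
    ← Finset.card_image_of_injOn (hinj.mono (Finset.coe_subset.2 Finset.sdiff_subset))]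
  refine (Finset.card_le_card (t := Finset.univ.image
    fun f : Copy (cycleGraph (n + 2)) G => (f : Fin (n + 2) → V)) ?_).trans Finset.card_image_le
  intro g hg
  obtain ⟨⟨x, p⟩, hp, rfl⟩ := Finset.mem_image.1 hg
  rw [Finset.mem_sdiff, degenerateClosedWalks, Finset.mem_filter, not_and] at hp
  obtain ⟨hl, hd⟩ := hp
  replace hd := hd hl
  rw [mem_closedWalks] at hl
  dsimp only at hl hd
  have hsucc : ∀ u : Fin (n + 2), G.Adj (p.getVert u) (p.getVert (u + 1 : Fin (n + 2))) := by
    intro u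
    have h1 := p.adj_getVert_succ (i := u) (by omega)
    rcases eq_or_ne u (Fin.last (n + 1)) with rfl | hu
    · simp only [Fin.val_last, Fin.last_add_one, Fin.val_zero, Walk.getVert_zero] at h1 ⊢
      rwa [p.getVert_of_length_le (i := n + 1 + 1) (by omega)] at h1
    · rwa [Fin.val_add_one_of_lt (Fin.lt_last_iff_ne_last.2 hu)]
  have hinj' : ∀ u v : Fin (n + 2), u < v → p.getVert u ≠ p.getVert v := fun u v huv h =>
    hd ⟨u, v - u, by have := Fin.lt_def.1 huv; omega, by omega, by
      rwa [Nat.add_sub_cancel' (Fin.lt_def.1 huv).le]⟩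
  refine Finset.mem_image.2 ⟨⟨⟨fun i => p.getVert i, fun {u v} huv => ?_⟩, fun u v huv => ?_⟩,
    Finset.mem_univ _, rfl⟩
  · rw [cycleGraph_adj] at huv
    rcases huv with h | h
    · rw [sub_eq_iff_eq_add'] at h
      subst h; exact (hsucc v).symm
    · rw [sub_eq_iff_eq_add'] at h
      subst h; exact hsucc u
  · rcases lt_trichotomy u v with h | h | h
    · exact absurd huv (hinj' u v h)
    · exact h
    · exact absurd huv.symm (hinj' v u h)

/-- There are at most `N ^ 2` positions for a repetition. For each of them the number of walks is
largest when the walk returns after two steps. -/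
lemma card_degenerate_closedWalks_le {N : ℕ} (hN : Even N) :
    ((G.degenerateClosedWalks N).card : ℝ) ≤
      (N : ℝ) ^ 2 * ∑ y, (G.adjMatrix ℝ ^ 2) y y * (G.adjMatrix ℝ ^ (N - 2)) y y := by
  classical
  set S : ℝ := ∑ y, (G.adjMatrix ℝ ^ 2) y y * (G.adjMatrix ℝ ^ (N - 2)) y y with hS
  have hS0 : 0 ≤ S := Finset.sum_nonneg fun y _ =>
    mul_nonneg (adjMatrix_pow_nonneg _ _ _) (adjMatrix_pow_nonneg _ _ _)
  let B : ℕ × ℕ → Finset (Σ x, G.Walk x x) := fun a =>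
    (G.closedWalks N).filter fun p =>
      (1 ≤ a.2 ∧ a.1 + a.2 < N) ∧ p.2.getVert a.1 = p.2.getVert (a.1 + a.2)
  have hsub : G.degenerateClosedWalks N ⊆
      (Finset.range N ×ˢ Finset.range N).biUnion B := by
    intro p hp
    obtain ⟨hp, i, d, h1, h2, h3⟩ := Finset.mem_filter.1 hp
    refine Finset.mem_biUnion.2 ⟨(i, d), ?_, Finset.mem_filter.2 ⟨hp, ⟨h1, h2⟩, h3⟩⟩
    simp; omega
  have hB : ∀ a, ((B a).card : ℝ) ≤ S := by
    rintro ⟨i, d⟩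
    by_cases hid : 1 ≤ d ∧ i + d < N
    · have h1 : ((B (i, d)).card : ℝ) ≤
          ∑ y, (G.adjMatrix ℝ ^ d) y y * (G.adjMatrix ℝ ^ (N - d)) y y := by
        simp only [B, hid, and_self, true_and]
        exact card_closedWalks_getVert_eq_le hid.2.le
      refine h1.trans ?_
      -- A return after one step is impossible, as there are no loops.
      have hdiag : ∀ y, (G.adjMatrix ℝ ^ 1) y y = 0 := by simp
      rcases Nat.lt_or_ge d 2 with h2 | h2
      · obtain rfl : d = 1 := by omega
        simpa [hdiag] using hS0
      rcases Nat.lt_or_ge N (d + 2) with h3 | h3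
      · obtain rfl : N = d + 1 := by omega
        simpa [hdiag] using hS0
      exact Finset.sum_le_sum fun y _ =>
        (G.isHermitian_adjMatrix ℝ).pow_diag_mul_pow_diag_le hN h2 h3 y
    · have : B (i, d) = ∅ := Finset.filter_eq_empty_iff.2 fun p _ h => hid h.1
      rw [this]; simpa using hS0
  calc _ ≤ (((Finset.range N ×ˢ Finset.range N).biUnion B).card : ℝ) := by
        exact_mod_cast Finset.card_le_card hsub
    _ ≤ ∑ a ∈ Finset.range N ×ˢ Finset.range N, ((B a).card : ℝ) := by
        exact_mod_cast Finset.card_biUnion_le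
    _ ≤ ∑ a ∈ Finset.range N ×ˢ Finset.range N, S := Finset.sum_le_sum fun a _ => hB a
    _ = _ := by simp [sq]

/-- A lower bound on the number of cycles, without asymptotics: the closed walks of length
`2 * q * k` minus the degenerate ones are labelled cycles, each cycle being labelled in at most
`4 * q * k` ways. The parameter `K` balances the two error terms. -/
lemma le_mul_copyCount_cycleGraph {k q : ℕ} (hk : 1 ≤ k) (hqk : 2 ≤ q * k) {M : ℕ}
    (hM : M ≤ G.copyCount (pathGraph (k + 1))) (hV : 1 ≤ Fintype.card V) {K : ℝ}
    (hK : ((2 * q * k : ℕ) : ℝ) ^ 2 ≤ K) :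
    (2 * (M : ℝ) / Fintype.card V) ^ (2 * q) * (1 - ((2 * q * k : ℕ) : ℝ) ^ 2 / K) -
      ((2 * q * k : ℕ) : ℝ) ^ 2 * (K ^ (q * k - 1) * (Fintype.card V : ℝ) ^ (2 * (q * k) - 2)) ≤
      4 * q * k * G.copyCount (cycleGraph (2 * q * k)) := by
  classical
  have hVne : Nonempty V := Fintype.card_pos_iff.1 hV
  have hVpos : (0 : ℝ) < Fintype.card V := by exact_mod_cast hV
  set N := 2 * q * k with hN
  have hN2 : N = 2 * (q * k) := by rw [hN, mul_assoc]
  have hKpos : 0 < K := lt_of_lt_of_le (by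
    have : (0 : ℝ) < N := by exact_mod_cast (by omega)
    positivity) hK
  set T : ℝ := ∑ x, (G.adjMatrix ℝ ^ N) x x with hT
  have hpath : 2 * (M : ℝ) ≤ ∑ x, ∑ y, (G.adjMatrix ℝ ^ k) x y := by
    refine le_trans ?_ (labelledCopyCount_pathGraph_le k)
    have h1 := two_mul_copyCount_le_labelledCopyCount G (pathGraphRev (k + 1))
      ⟨0, by
        intro h
        have := congrArg Fin.val h
        simp [pathGraphRev] at this
        omega⟩
    exact_mod_cast (Nat.mul_le_mul_left 2 hM).trans h1
  have hTge : (2 * (M : ℝ) / Fintype.card V) ^ (2 * q) ≤ T :=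
    (G.isHermitian_adjMatrix ℝ).div_pow_le_sum_pow_diag (by positivity)
      (by rwa [div_mul_cancel₀ _ hVpos.ne'])
  have hdeg := card_degenerate_closedWalks_le (G := G) (N := N) ⟨q * k, by omega⟩
  have hS := sum_sq_diag_mul_pow_diag_le (G := G) hqk hKpos hV
  rw [← hN2, ← hT] at hS
  rw [← hN2]
  obtain ⟨n, hn⟩ : ∃ n, N = n + 3 := ⟨N - 3, by omega⟩
  have hcyc : (G.labelledCopyCount (cycleGraph N) : ℝ) ≤
      4 * q * k * G.copyCount (cycleGraph N) := by
    have h1 := labelledCopyCount_le_mul_copyCount G (cycleGraph N)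
    have h2 : (cycleGraph N).labelledCopyCount (cycleGraph N) ≤ 2 * N := by
      rw [hn]; exact labelledCopyCount_cycleGraph_le n
    have h3 := h1.trans (Nat.mul_le_mul_right _ h2)
    calc _ ≤ ((2 * N * G.copyCount (cycleGraph N) : ℕ) : ℝ) := by exact_mod_cast h3
      _ = _ := by rw [hN]; push_cast; ring
  have hinj := card_injective_closedWalks_le (G := G) (n + 1)
  rw [show n + 1 + 2 = N by omega] at hinj
  have hsplit := Finset.card_sdiff_add_card_eq_card
    (G.degenerateClosedWalks_subset N)
  have hsplit' := congrArg (Nat.cast (R := ℝ)) hsplit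
  rw [card_closedWalks, ← hT, Nat.cast_add] at hsplit'
  have hinj' : _ ≤ (G.labelledCopyCount (cycleGraph N) : ℝ) := Nat.cast_le.2 hinj
  have hfac : 0 ≤ 1 - (N : ℝ) ^ 2 / K := by
    rw [sub_nonneg, div_le_one hKpos]; exact hK
  have h1 := mul_le_mul_of_nonneg_right hTge hfac
  have h2 := mul_le_mul_of_nonneg_left hS (sq_nonneg (N : ℝ))
  have h3 : T * (1 - (N : ℝ) ^ 2 / K) = T - (N : ℝ) ^ 2 * (T / K) := by ring
  linarith

end Count
end SimpleGraph

/-! ### The asymptotic bound -/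

lemma ofReal_le_satex {V W : Type*} {n m : ℕ} {F : SimpleGraph V} {G : SimpleGraph W} {x : ℝ}
    (h : ∀ Γ : SimpleGraph (Fin n), m ≤ Γ.copyCount F → x ≤ Γ.copyCount G) :
    ENNReal.ofReal x ≤ (satex n F m G : ℝ≥0∞) := by
  have h1 : ((⌈x⌉₊ : ℕ) : ℕ∞) ≤ satex n F m G :=
    le_iInf₂ fun Γ hΓ => Nat.cast_le.2 (Nat.ceil_le.2 (h Γ hΓ))
  calc ENNReal.ofReal x ≤ ENNReal.ofReal (⌈x⌉₊ : ℝ) := ENNReal.ofReal_le_ofReal (Nat.le_ceil x)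
    _ = ((⌈x⌉₊ : ℕ∞) : ℝ≥0∞) := by simp
    _ ≤ _ := ENat.toENNReal_le.2 h1

/-- With `a = M / n ^ (k + 1 - 1 / q)`, the quantity `(2 * M / n) ^ (2 * q)` exceeds
`n ^ (2 * q * k - 2)` by the factor `(2 * a) ^ (2 * q)`. -/
lemma two_mul_div_pow_eq {k q n : ℕ} (hq : 1 ≤ q) (hk : 1 ≤ k) (hn : 1 ≤ n) (M : ℝ) :
    (2 * M / n) ^ (2 * q) =
      (2 * (M / (n : ℝ) ^ ((k : ℝ) + 1 - 1 / (q : ℝ)))) ^ (2 * q) *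
        (n : ℝ) ^ (2 * (q * k) - 2) := by
  have hn0 : (0 : ℝ) < n := by exact_mod_cast hn
  have hq0 : (q : ℝ) ≠ 0 := by positivity
  set e : ℝ := (k : ℝ) + 1 - 1 / (q : ℝ) with he
  have hqk : 1 ≤ q * k := Nat.mul_pos hq hk
  have key : ((n : ℝ) ^ e) ^ (2 * q) = (n : ℝ) ^ (2 * q) * (n : ℝ) ^ (2 * (q * k) - 2) := by
    rw [← Real.rpow_natCast, ← Real.rpow_mul hn0.le, ← pow_add, ← Real.rpow_natCast]
    congr 1
    have h2 : 2 * q + (2 * (q * k) - 2) + 2 = 2 * q + 2 * (q * k) := by omega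
    have h3 : ((2 * q + (2 * (q * k) - 2) : ℕ) : ℝ) + 2 = 2 * q + 2 * (q * k) := by
      exact_mod_cast h2
    have h4 : ((2 * q + (2 * (q * k) - 2) : ℕ) : ℝ) = 2 * q + 2 * (q * k) - 2 := by linarith
    rw [h4, he]
    push_cast
    field_simp
    ring
  have hne : (n : ℝ) ^ e ≠ 0 := (Real.rpow_pos_of_pos hn0 _).ne'
  rw [← mul_div_assoc, div_pow (2 * M), div_pow (2 * M), key]
  field_simp

theorem mainTheorem9 (k q : ℕ) (hk : 1 ≤ k) (hq : 1 ≤ q) (hqk : 2 ≤ q * k)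
    (m : ℕ → ℕ)
    (hm : Tendsto (fun n : ℕ => (m n : ℝ) / (n : ℝ) ^ ((k : ℝ) + 1 - 1 / (q : ℝ))) atTop atTop) :
    ∃ ε : ℕ → ℝ, Tendsto ε atTop (𝓝 0) ∧
      ∀ᶠ n : ℕ in atTop,
        ENNReal.ofReal ((1 / (4 * (q : ℝ) * (k : ℝ)) + ε n) * (2 * (m n : ℝ) / (n : ℝ)) ^ (2 * q)) ≤
          (satex n (SimpleGraph.pathGraph (k + 1)) (m n)
            (SimpleGraph.cycleGraph (2 * q * k)) : ℝ≥0∞) := by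
  set C : ℝ := ((2 * q * k : ℕ) : ℝ) ^ 2 with hC
  set a : ℕ → ℝ := fun n => (m n : ℝ) / (n : ℝ) ^ ((k : ℝ) + 1 - 1 / (q : ℝ)) with ha
  have hl : ((q * k : ℕ) : ℝ) ≠ 0 := Nat.cast_ne_zero.2 (by omega)
  have hl0 : q * k ≠ 0 := by omega
  have hqkR : (0 : ℝ) < q * k := by exact_mod_cast (by omega : 0 < q * k)
  -- The threshold `K` has `K ^ (q * k) = (2 * a) ^ (2 * q)`. This choice makes the two error terms
  -- in the bound on the degenerate walks equal: both are `C / K` times the main term.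
  set K : ℕ → ℝ := fun n => ((2 * a n) ^ (2 * q)) ^ (((q * k : ℕ) : ℝ)⁻¹) with hK
  have hKtop : Tendsto K atTop atTop := by
    refine (tendsto_rpow_atTop (inv_pos.2 (lt_of_le_of_ne (Nat.cast_nonneg _) hl.symm))).comp ?_
    exact (tendsto_pow_atTop (by omega)).comp (hm.const_mul_atTop two_pos)
  refine ⟨fun n => -(2 * C / (4 * q * k)) * (K n)⁻¹, ?_, ?_⟩
  · simpa using hKtop.inv_tendsto_atTop.const_mul (-(2 * C / (4 * q * k)))
  filter_upwards [hKtop.eventually_ge_atTop C, hKtop.eventually_gt_atTop 0, eventually_ge_atTop 1]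
    with n hKC hKpos hn
  refine ofReal_le_satex fun Γ hΓ => ?_
  classical
  have h := SimpleGraph.le_mul_copyCount_cycleGraph (G := Γ) hk hqk hΓ (by simpa using hn) hKC
  rw [Fintype.card_fin, ← hC] at h
  have hX := two_mul_div_pow_eq hq hk hn (m n : ℝ)
  set X : ℝ := (2 * (m n : ℝ) / n) ^ (2 * q) with hXdef
  have hKpow : K n ^ (q * k) = (2 * a n) ^ (2 * q) :=
    Real.rpow_inv_natCast_pow (Even.pow_nonneg ⟨q, by ring⟩ _) hl0
  have hY : K n ^ (q * k - 1) * (n : ℝ) ^ (2 * (q * k) - 2) = X / K n := by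
    rw [hX, eq_div_iff hKpos.ne', ← hKpow]
    nth_rewrite 3 [show q * k = q * k - 1 + 1 by omega]
    rw [pow_succ]
    ring
  rw [hY] at h
  have h4 : (0 : ℝ) < 4 * q * k := by linarith
  rw [← mul_le_mul_iff_right₀ h4]
  refine le_trans (le_of_eq ?_) h
  field_simp
  ring
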